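/- All graphs are finite and simple. The treedepth $\mathrm{td}(G)$ is the minimum height (number of vertices on a longest root-to-leaf path) of a rooted forest $F$ for which there is an injective map $f:V(G)\to V(F)$ such that for every edge $uv$ of $G$ the vertices $f(u),f(v)$ are in ancestor-descendant relation in $F$. The treewidth $\mathrm{tw}(G)$ is the minimum of $\max_t|\beta(t)|-1$ over all tree decompositions $(T,\beta)$ of $G$ (for the graph without vertices we put $\mathrm{tw}(G)=0$). The length of a path is its number of edges, and the full binary tree of depth $h$ is the one with $h$ levels, i.e. with $2^h-1$ vertices, in which every vertex on a level other than the last has exactly two children. There is an absolute constant $c>0$ such that for every graph $G$ there is a nonnegative integer $$h \ \ge\ c\,\sqrt{\frac{\mathrm{td}(G)}{\mathrm{tw}(G)+1}}$$ for which $G$ contains either a simple path of length $2^h$ or a subdivision of the full binary tree of depth $h$ as a subgraph. Moreover, there is an absolute constant $C>0$ such that for every integer $k\ge 1$ and every graph $G$ with $\mathrm{td}(G)\ge Ck^3$, at least one of the following holds: 1. $\mathrm{tw}(G)\ge k$; 2. $G$ contains a subdivision of the full binary tree of depth $k$ as a subgraph; 3. $G$ contains a simple path of length $2^k$. -/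

import Mathlib

namespace SimpleGraph

/-- A partial order is (the ancestor-descendant order of) a *rooted forest* if the elements below
any element are pairwise comparable. Here `x ≤ y` means that `x` is `y` or an ancestor of `y`; the
roots are the minimal elements, and `Set.Iic x` is the set of vertices on the path from `x` to the
root of its tree. -/
def IsRootedForest (F : Type*) [PartialOrder F] : Prop :=
  ∀ x : F, IsChain (· ≤ ·) (Set.Iic x)

/-- `G` has a treedepth decomposition of width at most `k`: there are a finite rooted forest `F` of
height at most `k` (every path from a vertex to the root of its tree has at most `k` vertices) and
an injective map `f` from the vertices of `G` to those of `F` that sends the endpoints of every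
edge to vertices in ancestor-descendant relation. -/
def HasTreedepthDecomposition {V : Type*} (G : SimpleGraph V) (k : ℕ) : Prop :=
  ∃ (F : Type) (_ : Finite F) (_ : PartialOrder F),
    IsRootedForest F ∧ (∀ x : F, (Set.Iic x).ncard ≤ k) ∧
      ∃ f : V → F, Function.Injective f ∧ ∀ u v : V, G.Adj u v → f u ≤ f v ∨ f v ≤ f u

/-- The treedepth of a finite graph: the minimum width of a treedepth decomposition. -/
noncomputable def treedepth {V : Type*} (G : SimpleGraph V) : ℕ :=
  sInf {k : ℕ | G.HasTreedepthDecomposition k}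

/-- `(T, β)` is a tree decomposition of `G`: `T` is a tree, for every vertex `v` of `G` the nodes
whose bag contains `v` induce a connected nonempty subtree of `T` (Mathlib's `Connected` includes
nonemptiness), and every edge of `G` lies in some bag. -/
structure IsTreeDecomposition {V : Type*} (G : SimpleGraph V) {N : Type*} (T : SimpleGraph N)
    (β : N → Finset V) : Prop where
  isTree : T.IsTree
  connected : ∀ v : V, (T.induce {t : N | v ∈ β t}).Connected
  edge : ∀ u v : V, G.Adj u v → ∃ t : N, u ∈ β t ∧ v ∈ β t

/-- The treewidth of a finite graph: the least `w` such that `G` has a tree decomposition in which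
every bag has at most `w + 1` vertices. (For the graph without vertices this gives `0`.) -/
noncomputable def treewidth {V : Type*} (G : SimpleGraph V) : ℕ :=
  sInf {w : ℕ | ∃ (N : Type) (_ : Finite N) (T : SimpleGraph N) (β : N → Finset V),
    G.IsTreeDecomposition T β ∧ ∀ t : N, (β t).card ≤ w + 1}

/-- `G` contains a simple path of length `n`, that is, with `n` edges. -/
def HasPathOfLength {V : Type*} (G : SimpleGraph V) (n : ℕ) : Prop :=
  ∃ (u v : V) (p : G.Walk u v), p.IsPath ∧ p.length = n

/-- A subdivision of `H` as a (not necessarily induced) subgraph of `G`: distinct branch vertices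
of `G` for the vertices of `H`, and for every edge of `H` a path of `G` between the corresponding
branch vertices, which has no other branch vertex on it and meets the paths of the other edges of
`H` in branch vertices only. -/
structure SubdivisionIn {W V : Type*} (H : SimpleGraph W) (G : SimpleGraph V) where
  branch : W → V
  branch_injective : Function.Injective branch
  path : ∀ {a b : W}, H.Adj a b → G.Walk (branch a) (branch b)
  path_isPath : ∀ {a b : W} (h : H.Adj a b), (path h).IsPath
  path_symm : ∀ {a b : W} (h : H.Adj a b), path h.symm = (path h).reverse
  eq_end_of_branch_mem : ∀ {a b : W} (h : H.Adj a b) (w : W),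
    branch w ∈ (path h).support → w = a ∨ w = b
  disjoint : ∀ {a b c d : W} (h : H.Adj a b) (h' : H.Adj c d), s(a, b) ≠ s(c, d) →
    ∀ x : V, x ∈ (path h).support → x ∈ (path h').support → x ∈ Set.range branch

/-- `G` contains a subdivision of `H` as a subgraph. -/
def ContainsSubdivision {W V : Type*} (G : SimpleGraph V) (H : SimpleGraph W) : Prop :=
  Nonempty (SubdivisionIn H G)

/-- The full (perfect) binary tree of depth `h`, where depth counts the vertices on a root-to-leaf
path: the vertices are the binary words of length less than `h`, the root is the empty word, and
the children of a word `x` are `x0` and `x1`. It has `2 ^ h - 1` vertices; depth `1` is a single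
vertex. -/
def fullBinaryTree (h : ℕ) : SimpleGraph {l : List Bool // l.length < h} :=
  SimpleGraph.fromRel fun x y => ∃ b : Bool, y.1 = x.1 ++ [b]

end SimpleGraph

namespace SimpleGraph

/-! The link between treedepth and the two obstructions is `Splits`: how often a connected set can
be divided, recursively, into disjoint connected parts.

If no vertex set splits `r` times, then treedepth is at most `(tw + 1) * r`. Inside a component, the
connected subsets that split `r - 1` times pairwise intersect, for otherwise the component would
split once more. By the Helly property of subtrees, one bag of a tree decomposition meets all of
them. Deleting such a bag in every component lowers `r` by one and costs at most `tw + 1` ranks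
(`IsTreeDecomposition.exists_isRankingOn`, `IsRankingOn.treedepth_le`).

If some set splits `h * (h + 1)` times, a forest in `G` already witnesses this
(`Splits.exists_isAcyclic`), and every vertex ranking of that forest uses a value at least `h * (h +
1)` (`Splits.exists_le_rank`). Root the forest. With depth at most `2 ^ h` and no subdivided binary
tree of order `h`, ranking vertices lexicographically by Strahler number and then by the 2-adic
valuation of the depth uses only values below `h * (h + 1)` (`IsRootedForest.exists_isRankingOn`), a
contradiction. So a long path or a large binary tree exists. -/

/-- Any two vertices of `S` are joined by a walk of `G` inside `S`. -/
def ConnOn {V : Type*} (G : SimpleGraph V) (S : Set V) : Prop :=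
  ∀ u ∈ S, ∀ v ∈ S, ∃ p : G.Walk u v, ∀ x ∈ p.support, x ∈ S

/-! ### Connected vertex sets. -/

section ConnOn

variable {V : Type*} {G H : SimpleGraph V} {S S' : Set V}

lemma ConnOn.mono (h : ConnOn G S) (hGH : G ≤ H) : ConnOn H S := fun u hu v hv => by
  obtain ⟨p, hp⟩ := h u hu v hv
  exact ⟨p.mapLe hGH, by simpa using hp⟩

lemma connOn_of_induce_preconnected (h : (G.induce S).Preconnected) : ConnOn G S := by
  intro u hu v hv
  obtain ⟨p⟩ := h ⟨u, hu⟩ ⟨v, hv⟩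
  refine ⟨p.map (Embedding.induce S).toHom, fun x hx => ?_⟩
  have hx' : x ∈ (p.map (Embedding.induce S).toHom).support := hx
  rw [Walk.support_map, List.mem_map] at hx'
  obtain ⟨y, -, rfl⟩ := hx'
  exact y.2

lemma ConnOn.union (h : ConnOn G S) (h' : ConnOn G S') {w : V} (hw : w ∈ S) (hw' : w ∈ S') :
    ConnOn G (S ∪ S') := by
  have key : ∀ u ∈ S ∪ S', ∃ p : G.Walk u w, ∀ x ∈ p.support, x ∈ S ∪ S' := by
    rintro u (hu | hu)
    · obtain ⟨p, hp⟩ := h u hu w hw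
      exact ⟨p, fun x hx => Or.inl (hp x hx)⟩
    · obtain ⟨p, hp⟩ := h' u hu w hw'
      exact ⟨p, fun x hx => Or.inr (hp x hx)⟩
  intro u hu v hv
  obtain ⟨p, hp⟩ := key u hu
  obtain ⟨q, hq⟩ := key v hv
  refine ⟨p.append q.reverse, fun x hx => ?_⟩
  rw [Walk.mem_support_append_iff] at hx
  rcases hx with hx | hx
  · exact hp x hx
  · exact hq x (by simpa using hx)

lemma connOn_pair {u v : V} (h : G.Adj u v) : ConnOn G {u, v} := by
  rintro x (rfl | rfl) y (rfl | rfl)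
  · exact ⟨.nil, by simp⟩
  · exact ⟨.cons h .nil, by simp⟩
  · exact ⟨.cons h.symm .nil, by simp⟩
  · exact ⟨.nil, by simp⟩

lemma connOn_singleton (u : V) : ConnOn G {u} := by
  rintro x rfl y rfl
  exact ⟨.nil, by simp⟩

/-- A walk that leaves a set uses an edge that leaves this set. -/
lemma ConnOn.exists_crossing (h : ConnOn G S) {P : V → Prop} {u v : V} (hu : u ∈ S) (hv : v ∈ S)
    (hPu : P u) (hPv : ¬ P v) : ∃ x ∈ S, ∃ y ∈ S, G.Adj x y ∧ P x ∧ ¬ P y := by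
  obtain ⟨p, hp⟩ := h u hu v hv
  clear hu hv
  induction p with
  | nil => exact absurd hPu hPv
  | @cons a b c hab q ih =>
    by_cases hb : P b
    · exact ih hb hPv fun x hx => hp x (by simp [hx])
    · exact ⟨a, hp a (by simp), b, hp b (by simp), hab, hPu, hb⟩

end ConnOn

/-! ### Iterated splitting and its forest witnesses. -/

/-- `S` is connected and can be split `r` times in succession into two disjoint connected parts,
which need not cover the set that is split. -/
def Splits {V : Type*} (G : SimpleGraph V) : ℕ → Set V → Prop
  | 0, S => S.Nonempty ∧ ConnOn G S
  | r + 1, S => ConnOn G S ∧ ∃ A B, A ⊆ S ∧ B ⊆ S ∧ Disjoint A B ∧ Splits G r A ∧ Splits G r B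

section Splits

variable {V : Type*} {G H : SimpleGraph V}

lemma Splits.connOn : ∀ {r : ℕ} {S : Set V}, Splits G r S → ConnOn G S
  | 0, _, h => h.2
  | _ + 1, _, h => h.1

lemma Splits.nonempty : ∀ {r : ℕ} {S : Set V}, Splits G r S → S.Nonempty
  | 0, _, h => h.1
  | _ + 1, _, ⟨_, _, _, hA, _, _, h, _⟩ => h.nonempty.mono hA

lemma Splits.mono (hGH : G ≤ H) : ∀ {r : ℕ} {S : Set V}, Splits G r S → Splits H r S
  | 0, _, h => ⟨h.1, h.2.mono hGH⟩
  | _ + 1, _, ⟨h, A, B, hA, hB, hd, h1, h2⟩ =>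
    ⟨h.mono hGH, A, B, hA, hB, hd, h1.mono hGH, h2.mono hGH⟩

lemma edges_subset_of_mem {F₁ F₂ : SimpleGraph V} {A B : Set V} (hAB : Disjoint A B)
    (h₁ : ∀ u v, F₁.Adj u v → u ∈ A ∧ v ∈ A) (h₂ : ∀ u v, F₂.Adj u v → u ∈ B ∧ v ∈ B)
    {u v : V} (p : (F₁ ⊔ F₂).Walk u v) (hu : u ∈ A) : ∀ e ∈ p.edges, e ∈ F₁.edgeSet := by
  induction p with
  | nil => simp
  | @cons a b c hab q ih =>
    have hab' : F₁.Adj a b := by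
      rcases hab with hab | hab
      · exact hab
      · exact absurd (h₂ _ _ hab).1 (Set.disjoint_left.1 hAB hu)
    intro e he
    rw [Walk.edges_cons, List.mem_cons] at he
    rcases he with rfl | he
    · exact hab'
    · exact ih (h₁ _ _ hab').2 e he

/-- A closed walk starting in one part never leaves it, so a cycle of the union would already be a
cycle of one of the two forests. -/
lemma IsAcyclic.sup_of_disjoint {F₁ F₂ : SimpleGraph V} {A B : Set V} (hAB : Disjoint A B)
    (h₁ : ∀ u v, F₁.Adj u v → u ∈ A ∧ v ∈ A) (h₂ : ∀ u v, F₂.Adj u v → u ∈ B ∧ v ∈ B)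
    (ha₁ : F₁.IsAcyclic) (ha₂ : F₂.IsAcyclic) : (F₁ ⊔ F₂).IsAcyclic := by
  have key : ∀ (F₁ F₂ : SimpleGraph V) (A B : Set V), Disjoint A B →
      (∀ u v, F₁.Adj u v → u ∈ A ∧ v ∈ A) → (∀ u v, F₂.Adj u v → u ∈ B ∧ v ∈ B) →
      F₁.IsAcyclic → ∀ u (p : (F₁ ⊔ F₂).Walk u u), p.IsCycle → u ∉ A :=
    fun F₁ F₂ A B hAB h₁ h₂ ha u p hp hu =>
      ha _ (hp.transfer (edges_subset_of_mem hAB h₁ h₂ p hu))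
  intro u p hp
  have hA := key F₁ F₂ A B hAB h₁ h₂ ha₁ u p hp
  have hB : u ∉ B := by
    have hk := key F₂ F₁ B A hAB.symm h₂ h₁ ha₂
    rw [sup_comm] at hk
    exact hk u p hp
  cases p with
  | nil => exact hp.ne_nil rfl
  | cons h q =>
    rcases h with h | h
    · exact hA (h₁ _ _ h).1
    · exact hB (h₂ _ _ h).1

/-- An acyclic graph on `S` extends to one that connects `S`, if `S` is connected. -/
lemma exists_isAcyclic_connOn {S : Set V} (hS : ConnOn G S) {F₀ : SimpleGraph V} (hF₀ : F₀ ≤ G)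
    (hac : F₀.IsAcyclic) (hF₀S : ∀ u v, F₀.Adj u v → u ∈ S ∧ v ∈ S) :
    ∃ F, F₀ ≤ F ∧ F ≤ G ∧ F.IsAcyclic ∧ (∀ u v, F.Adj u v → u ∈ S ∧ v ∈ S) ∧ ConnOn F S := by
  -- Restricting to edges inside `S` keeps the extended forest in `S`; a maximal forest of `K` above
  -- `F₀` has the reachability of `K`.
  let K : SimpleGraph V :=
    { Adj := fun u v => G.Adj u v ∧ u ∈ S ∧ v ∈ S
      symm := ⟨fun u v h => ⟨h.1.symm, h.2.2, h.2.1⟩⟩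
      loopless := ⟨fun u h => G.loopless.irrefl u h.1⟩ }
  obtain ⟨F, h0, hFK, hF, hr⟩ := K.exists_isAcyclic_reachable_eq_le_of_le_of_isAcyclic
    (H := F₀) (fun u v h => ⟨hF₀ h, hF₀S u v h⟩) hac
  refine ⟨F, h0, fun u v h => (hFK h).1, hF, fun u v h => (hFK h).2, fun u hu v hv => ?_⟩
  have hK : K.Reachable u v := by
    obtain ⟨p, hp⟩ := hS u hu v hv
    clear hu hv
    induction p with
    | nil => rfl
    | @cons a b c hab q ih =>
      have h1 : K.Adj a b := ⟨hab, hp _ (by simp), hp _ (by simp)⟩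
      exact h1.reachable.trans (ih fun x hx => hp x (by simp [hx]))
  rw [← hr] at hK
  obtain ⟨p⟩ := hK
  refine ⟨p, ?_⟩
  clear hv
  induction p with
  | nil => simpa using hu
  | cons h q ih =>
    have := ih (hFK h).2.2
    intro x hx
    rw [Walk.support_cons, List.mem_cons] at hx
    rcases hx with rfl | hx
    · exact hu
    · exact this x hx

/-- Reduces the search for paths and binary trees to forests: the forests of the two disjoint parts
together form a forest, which extends to one connecting the whole set. -/
theorem Splits.exists_isAcyclic : ∀ {r : ℕ} {S : Set V}, Splits G r S →
    ∃ F ≤ G, F.IsAcyclic ∧ (∀ u v, F.Adj u v → u ∈ S ∧ v ∈ S) ∧ Splits F r S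
  | 0, S, h => by
    obtain ⟨F, -, h1, h2, h3, h4⟩ :=
      exists_isAcyclic_connOn h.2 bot_le isAcyclic_bot (fun u v h => h.elim)
    exact ⟨F, h1, h2, h3, h.1, h4⟩
  | r + 1, S, ⟨h, A, B, hA, hB, hd, h1, h2⟩ => by
    obtain ⟨F₁, hG₁, hc₁, hA₁, hs₁⟩ := h1.exists_isAcyclic
    obtain ⟨F₂, hG₂, hc₂, hA₂, hs₂⟩ := h2.exists_isAcyclic
    obtain ⟨F, h0, h1, h2, h3, h4⟩ := exists_isAcyclic_connOn h (sup_le hG₁ hG₂)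
      (IsAcyclic.sup_of_disjoint hd hA₁ hA₂ hc₁ hc₂) (by
        rintro u v (h | h)
        · exact ⟨hA (hA₁ _ _ h).1, hA (hA₁ _ _ h).2⟩
        · exact ⟨hB (hA₂ _ _ h).1, hB (hA₂ _ _ h).2⟩)
    exact ⟨F, h1, h2, h3, h4, A, B, hA, hB, hd, hs₁.mono (le_sup_left.trans h0),
      hs₂.mono (le_sup_right.trans h0)⟩

end Splits

/-! ### Rooting a forest. -/

section Order

variable {V : Type*} {F : SimpleGraph V}

/-- Uniqueness of the parent: geodesics from `r` through `p` and through `q` are both paths to `y`,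
hence equal, and so are their penultimate vertices. -/
lemma IsAcyclic.eq_of_dist_add_one (hF : F.IsAcyclic) {r y p q : V} (hr : F.Reachable r y)
    (hp : F.Adj p y) (hq : F.Adj q y) (hdp : F.dist r p + 1 = F.dist r y)
    (hdq : F.dist r q + 1 = F.dist r y) : p = q := by
  obtain ⟨P, hP⟩ := (hr.trans hp.symm.reachable).exists_walk_length_eq_dist
  obtain ⟨Q, hQ⟩ := (hr.trans hq.symm.reachable).exists_walk_length_eq_dist
  have h1 : (P.concat hp).IsPath := Walk.isPath_of_length_eq_dist _ (by simp [hP, hdp])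
  have h2 : (Q.concat hq).IsPath := Walk.isPath_of_length_eq_dist _ (by simp [hQ, hdq])
  have h3 := congrArg (fun p : F.Path r y => p.1.penultimate)
    ((hF.subsingleton_path r y).elim ⟨_, h1⟩ ⟨_, h2⟩)
  simpa using h3

/-- Choosing a root in each component of a forest `F` gives a rooted forest order whose covering
relation is the adjacency of `F`. -/
theorem IsAcyclic.exists_partialOrder (hF : F.IsAcyclic) :
    ∃ _ : PartialOrder V, IsRootedForest V ∧ hasse V = F := by
  let r : V → V := fun v => (F.connectedComponentMk v).out
  have hr : ∀ v, F.Reachable (r v) v := fun v => ConnectedComponent.exact (Quot.out_eq _)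
  have hr' : ∀ {u v}, F.Reachable u v → r u = r v := fun h => by
    simp only [r, ConnectedComponent.sound h]
  have step : ∀ {x y : V}, F.Reachable x y → F.dist (r y) x + F.dist x y = F.dist (r y) y → x ≠ y →
      ∃ p, F.Adj p y ∧ F.Reachable x p ∧ F.dist (r y) x + F.dist x p = F.dist (r y) p ∧
        F.dist (r y) p + 1 = F.dist (r y) y := by
    intro x y hxy hd hne
    obtain ⟨q, hq⟩ := hxy.symm.exists_walk_length_eq_dist
    cases q with
    | nil => exact absurd rfl hne
    | @cons _ p _ h q =>
      have h1 := F.dist_le q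
      have h2 : F.dist p y = 1 := dist_eq_one_iff_adj.2 h.symm
      have h3 := h.symm.reachable.dist_triangle_right (r y)
      have h4 := q.reverse.reachable.dist_triangle_right (r y)
      rw [Walk.length_cons, F.dist_comm] at hq
      rw [F.dist_comm] at h1
      exact ⟨p, h.symm, q.reverse.reachable, by omega, by omega⟩
  -- `x` precedes `y` when it lies on a geodesic from the root of the component to `y`.
  let le : V → V → Prop :=
    fun x y => F.Reachable x y ∧ F.dist (r y) x + F.dist x y = F.dist (r y) y
  let P : PartialOrder V :=
    { le := le
      le_refl := fun x => ⟨.rfl, by simp⟩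
      le_trans := by
        rintro x y z ⟨h1, h2⟩ ⟨h3, h4⟩
        rw [hr' h3] at h2
        have h5 := h1.dist_triangle_left z
        have h6 := (h1.trans h3).dist_triangle_right (r z)
        exact ⟨h1.trans h3, by omega⟩
      le_antisymm := by
        rintro x y ⟨h1, h2⟩ ⟨h3, h4⟩
        rw [hr' h1] at h4
        rw [SimpleGraph.dist_comm (u := y)] at h4
        exact h1.dist_eq_zero_iff.1 (by omega) }
  have hle : ∀ x y : V, x ≤ y ↔ F.Reachable x y ∧ F.dist (r y) x + F.dist x y = F.dist (r y) y :=
    fun x y => Iff.rfl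
  have hlt : ∀ {x y : V}, x < y → F.dist (r y) x < F.dist (r y) y := by
    intro x y h
    have h1 := (hle x y).1 h.le
    have h2 := h1.1.pos_dist_of_ne h.ne
    omega
  refine ⟨P, ?_, ?_⟩
  -- Induction on the distance to the root: two vertices strictly below `y` are both at or below its
  -- unique parent.
  · have key : ∀ n (y : V), F.dist (r y) y = n → ∀ x z, x ≤ y → z ≤ y → x ≤ z ∨ z ≤ x := by
      intro n
      induction n with
      | zero =>
        intro y hy x z hx hz
        have h1 : x = y := by
          by_contra h
          have := hlt (lt_of_le_of_ne hx h)
          omega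
        exact Or.inr (h1 ▸ hz)
      | succ n ih =>
        intro y hy x z hx hz
        by_cases h1 : x = y
        · exact Or.inr (h1 ▸ hz)
        by_cases h2 : z = y
        · exact Or.inl (h2 ▸ hx)
        obtain ⟨p, hp1, hp2, hp3, hp4⟩ := step hx.1 hx.2 h1
        obtain ⟨q, hq1, hq2, hq3, hq4⟩ := step hz.1 hz.2 h2
        obtain rfl := hF.eq_of_dist_add_one (hr y) hp1 hq1 hp4 hq4
        have hrp := hr' hp1.reachable
        exact ih p (by rw [hrp]; omega) x z ⟨hp2, by rw [hrp]; exact hp3⟩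
          ⟨hq2, by rw [hrp]; exact hq3⟩
    intro y x hx z hz _
    exact key _ y rfl x z hx hz
  · have key : ∀ {x y : V}, F.Adj x y → F.dist (r y) x + 1 = F.dist (r y) y → x ⋖ y := by
      intro x y h hd
      have h1 : F.dist x y = 1 := dist_eq_one_iff_adj.2 h
      have hxy : x ≤ y := ⟨h.reachable, by omega⟩
      refine ⟨lt_of_le_of_ne hxy h.ne, fun z h2 h3 => ?_⟩
      have h4 := hlt h2
      rw [hr' ((hle _ _).1 h3.le).1] at h4
      have h5 := hlt h3
      omega
    ext x y
    rw [hasse_adj]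
    constructor
    · have key' : ∀ {x y : V}, x ⋖ y → F.Adj x y := by
        intro x y h
        obtain ⟨p, h1, h2, h3, h4⟩ := step h.le.1 h.le.2 h.lt.ne
        have hrp := hr' h1.reachable
        have hxp : x ≤ p := ⟨h2, by rw [hrp]; exact h3⟩
        rcases hxp.eq_or_lt with rfl | hlt'
        · exact h1
        · exact absurd (key h1 h4).lt (h.2 hlt')
      rintro (h | h)
      · exact key' h
      · exact (key' h).symm
    · intro h
      rcases hF.dist_eq_dist_add_one_of_adj_of_reachable (r y) h
        ((hr y).trans h.symm.reachable) with h1 | h1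
      · exact Or.inr (key h.symm (by rw [hr' h.reachable]; omega))
      · exact Or.inl (key h (by omega))

end Order

/-! ### Connected sets in a rooted forest. -/

section RootedForest

variable {V : Type*} [PartialOrder V]

lemma IsRootedForest.le_or_le (hV : IsRootedForest V) {x y z : V} (hx : x ≤ z) (hy : y ≤ z) :
    x ≤ y ∨ y ≤ x := (hV z).total hx hy

/-- A set that is connected in the covering graph of a rooted forest is closed under taking
vertices between two of its vertices. -/
lemma IsRootedForest.mem_of_le_of_le (hV : IsRootedForest V) {S : Set V}
    (hS : ConnOn (hasse V) S) {u v z : V} (hu : u ∈ S) (hv : v ∈ S) (huz : u ≤ z) (hzv : z ≤ v) :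
    z ∈ S := by
  by_cases hzu : z ≤ u
  · exact le_antisymm huz hzu ▸ hu
  -- A walk from `v` to `u` must leave the up-set of `z`, and the only edge leaving it starts at
  -- `z`.
  obtain ⟨x, hx, y, -, hxy, hzx, hzy⟩ := hS.exists_crossing (P := (z ≤ ·)) hv hu hzv hzu
  rcases hxy with h | h
  · exact absurd (hzx.trans h.le) hzy
  · rcases hzx.eq_or_lt with rfl | h'
    · exact hx
    · rcases hV.le_or_le hzx h.le with h1 | h1
      · exact absurd h1 hzy
      · exact absurd h' (h.2 (lt_of_le_of_ne h1 fun e => hzy e.ge))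

/-- A nonempty set that is connected in the covering graph of a rooted forest has a least
element. -/
lemma IsRootedForest.exists_least [Finite V] (hV : IsRootedForest V) {S : Set V}
    (hS : ConnOn (hasse V) S) (hne : S.Nonempty) : ∃ t ∈ S, ∀ u ∈ S, t ≤ u := by
  obtain ⟨t, ht⟩ := S.toFinite.exists_minimal hne
  refine ⟨t, ht.1, fun u hu => ?_⟩
  by_contra htu
  obtain ⟨x, -, y, hy, hxy, htx, hty⟩ := hS.exists_crossing (P := (t ≤ ·)) ht.1 hu le_rfl htu
  rcases hxy with h | h
  · exact hty (htx.trans h.le)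
  · rcases hV.le_or_le htx h.le with h1 | h1
    · exact hty h1
    · exact hty (ht.2 hy h1)

/-- Two vertices of a connected set have a greatest common lower bound, and it is in the set. -/
lemma IsRootedForest.exists_meet [Finite V] (hV : IsRootedForest V) {S : Set V}
    (hS : ConnOn (hasse V) S) {u v : V} (hu : u ∈ S) (hv : v ∈ S) :
    ∃ m ∈ S, m ≤ u ∧ m ≤ v ∧ ∀ z, z ≤ u → z ≤ v → z ≤ m := by
  obtain ⟨t, ht, htS⟩ := hV.exists_least hS ⟨u, hu⟩
  obtain ⟨m, hm⟩ := {x | x ∈ S ∧ x ≤ u ∧ x ≤ v}.toFinite.exists_maximal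
    ⟨t, ht, htS u hu, htS v hv⟩
  refine ⟨m, hm.1.1, hm.1.2.1, hm.1.2.2, fun z hzu hzv => ?_⟩
  rcases hV.le_or_le hzu hm.1.2.1 with h | h
  · exact h
  · exact hm.2 ⟨hV.mem_of_le_of_le hS hm.1.1 hu h hzu, hzu, hzv⟩ h

end RootedForest

/-! ### The Helly property and tree decompositions. -/

section Helly

/-- The Helly property of subtrees: pairwise intersecting subtrees of a tree have a common
node. -/
theorem IsTree.exists_mem_of_pairwise_inter {N ι : Type*} [Finite N] {T : SimpleGraph N}
    (hT : T.IsTree) (A : ι → Set N) (hA : ∀ i, ConnOn T (A i))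
    (hAA : ∀ i j, (A i ∩ A j).Nonempty) : ∃ t, ∀ i, t ∈ A i := by
  obtain ⟨P, hN, rfl⟩ := hT.isAcyclic.exists_partialOrder
  rcases isEmpty_or_nonempty ι with h | ⟨⟨i₀⟩⟩
  · exact ⟨hT.connected.nonempty.some, fun i => h.elim i⟩
  have hne : ∀ i, (A i).Nonempty := fun i => by simpa using hAA i i
  choose t ht htop using fun i => hN.exists_least (hA i) (hne i)
  -- A deepest of the least elements works: `A j` meets `A i` in some `x`, and `t j ≤ t i ≤ x` puts
  -- `t i` in `A j` by convexity.
  obtain ⟨s, ⟨i, rfl⟩, hs⟩ := (Set.range t).toFinite.exists_maximal ⟨t i₀, i₀, rfl⟩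
  refine ⟨t i, fun j => ?_⟩
  obtain ⟨x, hxi, hxj⟩ := hAA i j
  have h : t j ≤ t i := by
    rcases hN.le_or_le (htop j x hxj) (htop i x hxi) with h | h
    · exact h
    · exact hs ⟨j, rfl⟩ h
  exact hN.mem_of_le_of_le (hA j) (ht j) hxj h (htop i x hxi)

variable {V N : Type*} {G : SimpleGraph V} {T : SimpleGraph N} {β : N → Finset V}

/-- The nodes whose bags meet a connected set form a connected set. -/
lemma IsTreeDecomposition.connOn_inter (hT : G.IsTreeDecomposition T β) {S : Set V}
    (hS : ConnOn G S) : ConnOn T {t | ∃ x ∈ S, x ∈ β t} := by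
  rintro t ⟨x, hx, hxt⟩ t' ⟨x', hx', hxt'⟩
  obtain ⟨p, hp⟩ := hS x hx x' hx'
  clear hx hx'
  have single : ∀ {v : V} {a b : N}, v ∈ S → v ∈ β a → v ∈ β b →
      ∃ q : T.Walk a b, ∀ y ∈ q.support, ∃ x ∈ S, x ∈ β y := by
    intro v a b hv ha hb
    obtain ⟨q, hq⟩ := connOn_of_induce_preconnected (hT.connected v).preconnected a ha b hb
    exact ⟨q, fun y hy => ⟨v, hv, hq y hy⟩⟩
  induction p generalizing t with
  | nil => exact single (hp _ (by simp)) hxt hxt'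
  | @cons a b c hab q ih =>
    obtain ⟨s, hs1, hs2⟩ := hT.edge a b hab
    obtain ⟨q1, hq1⟩ := single (hp a (by simp)) hxt hs1
    obtain ⟨q2, hq2⟩ := ih s hs2 hxt' fun x hx => hp x (by simp [hx])
    refine ⟨q1.append q2, fun y hy => ?_⟩
    rw [Walk.mem_support_append_iff] at hy
    exact hy.elim (hq1 y) (hq2 y)

end Helly

/-! ### Vertex rankings, treedepth and splitting. -/

section Ranking

variable {V : Type*} {G : SimpleGraph V}

/-- `ρ` is a vertex ranking of `X`: every connected subset of `X` has only one vertex of the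
largest value. -/
def IsRankingOn (G : SimpleGraph V) (X : Set V) (ρ : V → ℕ) : Prop :=
  ∀ S ⊆ X, ConnOn G S → ∀ u ∈ S, ∀ v ∈ S, u ≠ v → ρ u = ρ v → ∃ w ∈ S, ρ u < ρ w

/-- A vertex ranking with `k` values gives a treedepth decomposition of width `k`. -/
theorem IsRankingOn.treedepth_le [Finite V] {ρ : V → ℕ} {k : ℕ}
    (h : IsRankingOn G Set.univ ρ) (hk : ∀ v, ρ v < k) : G.treedepth ≤ k := by
  apply Nat.sInf_le
  -- `u` is an ancestor of `v` when `u` has the largest value in some connected set containing both;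
  -- the ranking property is exactly what antisymmetry needs.
  let P : PartialOrder V :=
    { le := fun u v => ∃ S, ConnOn G S ∧ u ∈ S ∧ v ∈ S ∧ ∀ w ∈ S, ρ w ≤ ρ u
      le_refl := fun u => ⟨{u}, connOn_singleton u, rfl, rfl, by rintro w rfl; exact le_rfl⟩
      le_trans := by
        rintro x y z ⟨S, hS, hx, hy, hm⟩ ⟨S', hS', hy', hz, hm'⟩
        refine ⟨S ∪ S', hS.union hS' hy hy', Or.inl hx, Or.inr hz, ?_⟩
        rintro w (hw | hw)
        · exact hm w hw
        · exact (hm' w hw).trans (hm y hy)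
      le_antisymm := by
        rintro x y ⟨S, hS, hx, hy, hm⟩ ⟨S', hS', hy', hx', hm'⟩
        by_contra hne
        obtain ⟨w, hw, hlt⟩ := h S (Set.subset_univ _) hS x hx y hy hne
          (le_antisymm (hm' x hx') (hm y hy))
        exact absurd (hm w hw) (by omega) }
  have hchain : ∀ x u v : V, u ≤ x → v ≤ x → ρ u ≤ ρ v → v ≤ u := by
    rintro x u v ⟨S, hS, hu, hx, hm⟩ ⟨S', hS', hv, hx', hm'⟩ huv
    refine ⟨S ∪ S', hS.union hS' hx hx', Or.inr hv, Or.inl hu, ?_⟩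
    rintro w (hw | hw)
    · exact (hm w hw).trans huv
    · exact hm' w hw
  obtain ⟨n, ⟨e⟩⟩ := Finite.exists_equiv_fin V
  let Q : PartialOrder (Fin n) := PartialOrder.lift e.symm e.symm.injective
  refine ⟨Fin n, inferInstance, Q, ?_, ?_, e, e.injective, ?_⟩
  · intro x a ha b hb _
    rcases le_total (ρ (e.symm a)) (ρ (e.symm b)) with hab | hab
    · exact Or.inr (hchain _ _ _ ha hb hab)
    · exact Or.inl (hchain _ _ _ hb ha hab)
  · intro x
    -- The values are injective on the ancestors of a vertex, so there are at most `k` of them.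
    rw [← Set.InjOn.ncard_image (f := fun a => ρ (e.symm a))]
    · refine (Set.ncard_le_ncard (t := Set.Iio k) ?_ (Set.finite_Iio k)).trans ?_
      · rintro _ ⟨a, -, rfl⟩
        exact hk _
      · rw [← Nat.card_coe_set_eq]; simp
    · intro a ha b hb hab
      have hab : ρ (e.symm a) = ρ (e.symm b) := hab
      exact e.symm.injective
        (le_antisymm (hchain _ _ _ hb ha hab.ge) (hchain _ _ _ ha hb hab.le))
  · intro u v huv
    change e.symm (e u) ≤ e.symm (e v) ∨ e.symm (e v) ≤ e.symm (e u)
    simp only [Equiv.symm_apply_apply]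
    rcases le_total (ρ u) (ρ v) with h' | h'
    · refine Or.inr ⟨{u, v}, connOn_pair huv, by simp, by simp, ?_⟩
      rintro w (rfl | rfl)
      exacts [h', le_rfl]
    · refine Or.inl ⟨{u, v}, connOn_pair huv, by simp, by simp, ?_⟩
      rintro w (rfl | rfl)
      exacts [le_rfl, h']

/-- The vertices that are reachable from `v` inside `X`. -/
def componentIn (G : SimpleGraph V) (X : Set V) (v : V) : Set V :=
  {u | ∃ S ⊆ X, ConnOn G S ∧ v ∈ S ∧ u ∈ S}

lemma componentIn_subset (X : Set V) (v : V) : componentIn G X v ⊆ X := by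
  rintro u ⟨S, hS, -, -, hu⟩
  exact hS hu

lemma subset_componentIn {X S : Set V} {v : V} (hSX : S ⊆ X) (hS : ConnOn G S) (hv : v ∈ S) :
    S ⊆ componentIn G X v := fun _ hu => ⟨S, hSX, hS, hv, hu⟩

lemma connOn_componentIn (X : Set V) (v : V) : ConnOn G (componentIn G X v) := by
  rintro a ⟨S, hSX, hS, hv, ha⟩ b ⟨S', hSX', hS', hv', hb⟩
  obtain ⟨p, hp⟩ := hS.union hS' hv hv' a (Or.inl ha) b (Or.inr hb)
  exact ⟨p, fun x hx => ⟨S ∪ S', Set.union_subset hSX hSX', hS.union hS' hv hv', Or.inl hv, hp x hx⟩⟩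

lemma componentIn_eq {X : Set V} {u v : V} (hu : u ∈ componentIn G X v) :
    componentIn G X u = componentIn G X v := by
  obtain ⟨S, hSX, hS, hv, hu⟩ := hu
  ext w
  constructor
  · rintro ⟨S', hSX', hS', hu', hw⟩
    exact ⟨S ∪ S', Set.union_subset hSX hSX', hS.union hS' hu hu', Or.inl hv, Or.inr hw⟩
  · rintro ⟨S', hSX', hS', hv', hw⟩
    exact ⟨S ∪ S', Set.union_subset hSX hSX', hS.union hS' hv hv', Or.inl hu, Or.inr hw⟩

/-- If no subset of `X` splits `r` times, then removing one bag from each component of `X`, and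
doing this `r` times in succession, removes all vertices of `X`. -/
theorem IsTreeDecomposition.exists_isRankingOn {N : Type*} [Finite N] {T : SimpleGraph N}
    {β : N → Finset V} (hT : G.IsTreeDecomposition T β) {k : ℕ} (hk : ∀ t, (β t).card ≤ k) :
    ∀ (r : ℕ) (X : Set V), (∀ S ⊆ X, ¬ Splits G r S) →
      ∃ ρ : V → ℕ, (∀ v ∈ X, ρ v < k * r) ∧ IsRankingOn G X ρ
  | 0, X, hX => by
    have hX0 : ∀ v, v ∉ X := fun v hv =>
      hX {v} (by simpa using hv) ⟨Set.singleton_nonempty v, connOn_singleton v⟩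
    exact ⟨0, fun v hv => absurd hv (hX0 v), fun S hS _ u hu => absurd (hS hu) (hX0 u)⟩
  | r + 1, X, hX => by
    classical
    -- Two disjoint subsets of `C` that split `r` times would make `C` split `r + 1` times, so Helly
    -- applies to the node sets whose bags meet them.
    have hbag : ∀ C : Set V, ∃ t, C ⊆ X → ConnOn G C →
        ∀ S ⊆ C, Splits G r S → ∃ x ∈ S, x ∈ β t := by
      intro C
      by_cases hC : C ⊆ X ∧ ConnOn G C
      · obtain ⟨t, ht⟩ := hT.isTree.exists_mem_of_pairwise_inter
          (fun S : {S // S ⊆ C ∧ Splits G r S} => {t | ∃ x ∈ S.1, x ∈ β t})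
          (fun S => hT.connOn_inter S.2.2.connOn) (by
            rintro ⟨A, hA, hA'⟩ ⟨B, hB, hB'⟩
            have : ¬ Disjoint A B := fun hd => hX C hC.1 ⟨hC.2, A, B, hA, hB, hd, hA', hB'⟩
            obtain ⟨x, hx, hx'⟩ := Set.not_disjoint_iff.1 this
            obtain ⟨⟨t, ht⟩⟩ := (hT.connected x).nonempty
            exact ⟨t, ⟨x, hx, ht⟩, ⟨x, hx', ht⟩⟩)
        exact ⟨t, fun _ _ S hS hS' => ht ⟨S, hS, hS'⟩⟩
      · exact ⟨hT.isTree.connected.nonempty.some, fun h1 h2 => absurd ⟨h1, h2⟩ hC⟩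
    choose t ht using hbag
    let B : V → Finset V := fun v => β (t (componentIn G X v))
    obtain ⟨ρ, hρ, hr⟩ := hT.exists_isRankingOn hk r {v | v ∈ X ∧ v ∉ B v} (by
      intro S hS hS'
      obtain ⟨v, hv⟩ := hS'.nonempty
      have hSX : S ⊆ X := fun x hx => (hS hx).1
      have hSC := subset_componentIn hSX hS'.connOn hv
      obtain ⟨x, hx, hxt⟩ := ht _ (componentIn_subset X v) (connOn_componentIn X v) S hSC hS'
      refine (hS hx).2 ?_
      simp only [B, componentIn_eq (hSC hx)]
      exact hxt)
    let idx : Finset V → V → ℕ := fun s v => if h : v ∈ s then s.equivFin ⟨v, h⟩ else 0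
    have hidx : ∀ (s : Finset V) (v : V), v ∈ s → idx s v < s.card := by
      intro s v hv
      simp only [idx, dif_pos hv]
      exact Fin.is_lt _
    have hidx' : ∀ (s : Finset V) (u v : V), u ∈ s → v ∈ s → idx s u = idx s v → u = v := by
      intro s u v hu hv h
      simp only [idx, dif_pos hu, dif_pos hv] at h
      simpa using s.equivFin.injective (Fin.ext h)
    -- Deleted vertices get the top `k` values, distinct within each bag; the others keep their
    -- inductive value below `k * r`.
    refine ⟨fun v => if v ∈ B v then k * r + idx (B v) v else ρ v, ?_, ?_⟩
    · intro v hv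
      simp only [mul_add, mul_one]
      split_ifs with h
      · have h1 := hidx _ _ h
        have h2 : (B v).card ≤ k := hk _
        omega
      · have := hρ v ⟨hv, h⟩
        omega
    · intro S hSX hS u hu v hv hne heq
      have hC := componentIn_eq (subset_componentIn hSX hS hu hv)
      have hB : B v = B u := by simp only [B, hC]
      by_cases h1 : u ∈ B u <;> by_cases h2 : v ∈ B v
      · simp only [if_pos h1, if_pos h2] at heq
        rw [hB] at heq h2
        exact absurd (hidx' _ _ _ h1 h2 (by omega)) hne
      · simp only [if_pos h1, if_neg h2] at heq
        have := hρ v ⟨hSX hv, h2⟩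
        omega
      · simp only [if_neg h1, if_pos h2] at heq
        have := hρ u ⟨hSX hu, h1⟩
        omega
      · simp only [if_neg h1, if_neg h2] at heq ⊢
        by_cases hS' : ∀ w ∈ S, w ∉ B w
        · obtain ⟨w, hw, hlt⟩ := hr S (fun w hw => ⟨hSX hw, hS' w hw⟩) hS u hu v hv hne heq
          exact ⟨w, hw, by rwa [if_neg (hS' w hw)]⟩
        · push Not at hS'
          obtain ⟨w, hw, hwB⟩ := hS'
          have := hρ u ⟨hSX hu, h1⟩
          exact ⟨w, hw, by rw [if_pos hwB]; omega⟩

/-- Both halves contain a vertex of value at least `r`; if these two values tie, the ranking forces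
a larger one in `S`. -/
lemma Splits.exists_le_rank {X : Set V} {ρ : V → ℕ} (hρ : IsRankingOn G X ρ) :
    ∀ {r : ℕ} {S : Set V}, S ⊆ X → Splits G r S → ∃ v ∈ S, r ≤ ρ v
  | 0, _, _, ⟨⟨v, hv⟩, _⟩ => ⟨v, hv, Nat.zero_le _⟩
  | r + 1, S, hSX, ⟨hS, A, B, hA, hB, hd, h1, h2⟩ => by
    obtain ⟨a, ha, hra⟩ := h1.exists_le_rank hρ (hA.trans hSX)
    obtain ⟨b, hb, hrb⟩ := h2.exists_le_rank hρ (hB.trans hSX)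
    rcases lt_trichotomy (ρ a) (ρ b) with h | h | h
    · exact ⟨b, hB hb, by omega⟩
    · obtain ⟨w, hw, hlt⟩ := hρ S hSX hS a (hA ha) b (hB hb)
        (fun e => Set.disjoint_left.1 hd ha (e ▸ hb)) h
      exact ⟨w, hw, by omega⟩
    · exact ⟨a, hA ha, by omega⟩

end Ranking

/-! ### Depth and vertical paths. -/

section Depth

/-- The number of vertices on the path from `v` to the root of its tree. -/
noncomputable def forestDepth {V : Type*} [PartialOrder V] (v : V) : ℕ := (Set.Iic v).ncard

variable {V : Type*} [PartialOrder V] [Finite V]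

lemma forestDepth_pos (v : V) : 0 < forestDepth v :=
  (Set.ncard_pos (Set.toFinite _)).2 ⟨v, le_rfl⟩

lemma forestDepth_lt {u v : V} (h : u < v) : forestDepth u < forestDepth v :=
  Set.ncard_lt_ncard (Set.Iic_ssubset_Iic.2 h) (Set.toFinite _)

lemma forestDepth_mono {u v : V} (h : u ≤ v) : forestDepth u ≤ forestDepth v :=
  Set.ncard_le_ncard (Set.Iic_subset_Iic.2 h) (Set.toFinite _)

lemma IsRootedForest.forestDepth_covBy (hV : IsRootedForest V) {p v : V} (h : p ⋖ v) :
    forestDepth v = forestDepth p + 1 := by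
  have : Set.Iic v = insert v (Set.Iic p) := by
    ext z
    simp only [Set.mem_Iic, Set.mem_insert_iff]
    constructor
    · intro hz
      rcases hz.eq_or_lt with rfl | hz'
      · exact Or.inl rfl
      · rcases hV.le_or_le hz h.le with h1 | h1
        · exact Or.inr h1
        · rcases h1.eq_or_lt with rfl | h2
          · exact Or.inr le_rfl
          · exact absurd hz' (h.2 h2)
    · rintro (rfl | hz)
      exacts [le_rfl, hz.trans h.le]
  have hvp : v ∉ Set.Iic p := fun hv => absurd h.lt (not_lt_of_ge hv)
  rw [forestDepth, this, Set.ncard_insert_of_notMem hvp (Set.toFinite _), forestDepth]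

/-- The vertices below `v` attain all depths up to that of `v`. -/
lemma IsRootedForest.exists_le_forestDepth_eq (hV : IsRootedForest V) {n : ℕ} (hn : 0 < n) (v : V)
    (hv : n ≤ forestDepth v) : ∃ w ≤ v, forestDepth w = n := by
  induction v using WellFoundedLT.induction with
  | ind v ih =>
    by_cases hm : IsMin v
    · have : Set.Iic v = {v} := by
        ext z
        simp only [Set.mem_Iic, Set.mem_singleton_iff]
        exact ⟨fun h => h.antisymm (hm h), fun h => h.le⟩
      have h1 : forestDepth v = 1 := by rw [forestDepth, this, Set.ncard_singleton]
      exact ⟨v, le_rfl, by omega⟩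
    · rw [not_isMin_iff] at hm
      obtain ⟨u, hu⟩ := hm
      obtain ⟨p, -, hp⟩ := exists_le_covBy_of_lt hu
      have h1 := hV.forestDepth_covBy hp
      rcases hv.eq_or_lt with h2 | h2
      · exact ⟨v, le_rfl, h2.symm⟩
      · obtain ⟨w, hw, hwn⟩ := ih p hp.lt (by omega)
        exact ⟨w, hw.trans hp.le, hwn⟩

/-- Between a vertex and a descendant there is a path through vertices in between. -/
lemma IsRootedForest.exists_isPath (hV : IsRootedForest V) {u v : V} (huv : u ≤ v) :
    ∃ p : (hasse V).Walk u v, p.IsPath ∧ (∀ x ∈ p.support, u ≤ x ∧ x ≤ v) ∧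
      p.length + forestDepth u = forestDepth v := by
  induction v using WellFoundedLT.induction with
  | ind v ih =>
    rcases huv.eq_or_lt with rfl | h
    · exact ⟨.nil, by simp, by simp, by simp⟩
    · obtain ⟨w, huw, hw⟩ := exists_le_covBy_of_lt h
      obtain ⟨p, hp, hps, hpl⟩ := ih w hw.lt huw
      have hadj : (hasse V).Adj w v := Or.inl hw
      refine ⟨p.concat hadj, hp.concat (fun hv => absurd hw.lt (not_lt_of_ge (hps v hv).2)) _,
        fun x hx => ?_, ?_⟩
      · rw [Walk.support_concat, List.mem_append, List.mem_singleton] at hx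
        rcases hx with hx | rfl
        · exact ⟨(hps x hx).1, (hps x hx).2.trans hw.le⟩
        · exact ⟨huv, le_rfl⟩
      · rw [Walk.length_concat, hV.forestDepth_covBy hw]
        omega

lemma IsRootedForest.hasPathOfLength (hV : IsRootedForest V) {n : ℕ} {v : V}
    (hv : n < forestDepth v) : (hasse V).HasPathOfLength n := by
  obtain ⟨u, huv, hu⟩ := hV.exists_le_forestDepth_eq (n := forestDepth v - n) (by omega) v (by omega)
  obtain ⟨p, hp, -, hpl⟩ := hV.exists_isPath huv
  exact ⟨u, v, p, hp, by omega⟩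

end Depth

/-! ### Subdivided binary trees in a rooted forest. -/

section BinaryTree

/-- `v` is the root of a subdivision of the full binary tree with `r + 1` levels, whose paths go
away from the root of the forest. -/
def IsBinaryRoot {V : Type*} [PartialOrder V] : ℕ → V → Prop
  | 0, _ => True
  | r + 1, v => ∃ a b, v < a ∧ v < b ∧ IsBinaryRoot r a ∧ IsBinaryRoot r b ∧
      ∀ z, z ≤ a → z ≤ b → z ≤ v

variable {V : Type*} [PartialOrder V]

lemma IsBinaryRoot.exists_branch : ∀ {r : ℕ} {v : V}, IsBinaryRoot r v →
    ∃ b : List Bool → V, b [] = v ∧ ∀ x : List Bool, x.length < r →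
      (∀ c, b x < b (x ++ [c])) ∧ ∀ z, z ≤ b (x ++ [false]) → z ≤ b (x ++ [true]) → z ≤ b x
  | 0, v, _ => ⟨fun _ => v, rfl, fun x hx => absurd hx (Nat.not_lt_zero _)⟩
  | r + 1, v, ⟨a₀, a₁, h₀, h₁, hr₀, hr₁, hm⟩ => by
    obtain ⟨b₀, hb₀, hx₀⟩ := hr₀.exists_branch
    obtain ⟨b₁, hb₁, hx₁⟩ := hr₁.exists_branch
    let b : List Bool → V := fun x => match x with
      | [] => v
      | false :: y => b₀ y
      | true :: y => b₁ y
    refine ⟨b, rfl, fun x hx => ?_⟩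
    match x with
    | [] => exact ⟨fun c => by cases c <;> simpa [b, hb₀, hb₁], by simpa [b, hb₀, hb₁] using hm⟩
    | false :: y => exact hx₀ y (by simpa using hx)
    | true :: y => exact hx₁ y (by simpa using hx)

lemma list_bool_trichotomy : ∀ x y : List Bool, x <+: y ∨ y <+: x ∨
    ∃ p c, p ++ [c] <+: x ∧ p ++ [!c] <+: y
  | [], y => Or.inl List.nil_prefix
  | x, [] => Or.inr (Or.inl List.nil_prefix)
  | c :: x, d :: y => by
    by_cases hcd : c = d
    · subst hcd
      rcases list_bool_trichotomy x y with h | h | ⟨p, e, h1, h2⟩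
      · exact Or.inl (by simpa using h)
      · exact Or.inr (Or.inl (by simpa using h))
      · exact Or.inr (Or.inr ⟨c :: p, e, by simpa using h1, by simpa using h2⟩)
    · obtain rfl : d = !c := by cases c <;> cases d <;> simp_all
      exact Or.inr (Or.inr ⟨[], c, by simp, by simp⟩)

/-- A map from the binary words of length at most `r` to a rooted forest as in
`IsBinaryRoot.exists_branch`. -/
structure IsBranching (r : ℕ) (b : List Bool → V) : Prop where
  lt : ∀ x : List Bool, x.length < r → ∀ c, b x < b (x ++ [c])
  meet : ∀ x : List Bool, x.length < r → ∀ z, z ≤ b (x ++ [false]) → z ≤ b (x ++ [true]) → z ≤ b x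

namespace IsBranching

variable {r : ℕ} {b : List Bool → V}

lemma meet' (hb : IsBranching r b) {x : List Bool} (hx : x.length < r) (c : Bool) {z : V}
    (h : z ≤ b (x ++ [c])) (h' : z ≤ b (x ++ [!c])) : z ≤ b x := by
  cases c
  · exact hb.meet x hx z h h'
  · exact hb.meet x hx z h' h

lemma le_append (hb : IsBranching r b) (x l : List Bool) (h : (x ++ l).length ≤ r) :
    b x ≤ b (x ++ l) := by
  induction l generalizing x with
  | nil => simp
  | cons c l ih =>
    have h1 : x ++ c :: l = (x ++ [c]) ++ l := by simp
    rw [h1] at h ⊢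
    refine (hb.lt x ?_ c).le.trans (ih _ h)
    simp at h
    omega

lemma le_of_prefix (hb : IsBranching r b) {x y : List Bool} (h : x <+: y) (hy : y.length ≤ r) :
    b x ≤ b y := by
  obtain ⟨l, rfl⟩ := h
  exact hb.le_append x l hy

lemma lt_of_prefix (hb : IsBranching r b) {x y : List Bool} (h : x <+: y) (hxy : x ≠ y)
    (hy : y.length ≤ r) : b x < b y := by
  obtain ⟨l, rfl⟩ := h
  cases l with
  | nil => simp at hxy
  | cons c l =>
    have h1 : x ++ c :: l = (x ++ [c]) ++ l := by simp
    rw [h1] at hy ⊢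
    refine (hb.lt x ?_ c).trans_le (hb.le_append _ _ hy)
    simp at hy
    omega

/-- If the words diverge after `p`, the images of the two children of `p` are incomparable; `z` can
be above neither, so it is below both and the meet condition applies. Injectivity and disjointness
of the subdivision both rest on this. -/
lemma exists_prefix (hb : IsBranching r b) (hV : IsRootedForest V) {x y : List Bool}
    (hx : x.length ≤ r) (hy : y.length ≤ r) {z : V} (hzx : z ≤ b x) (hzy : z ≤ b y) :
    ∃ p, p <+: x ∧ p <+: y ∧ z ≤ b p := by
  rcases list_bool_trichotomy x y with h | h | ⟨p, c, h1, h2⟩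
  · exact ⟨x, List.prefix_refl _, h, hzx⟩
  · exact ⟨y, h, List.prefix_refl _, hzy⟩
  · refine ⟨p, (List.prefix_append _ _).trans h1, (List.prefix_append _ _).trans h2, ?_⟩
    have hp : p.length < r := by
      have := h1.length_le
      simp at this
      omega
    have h3 := hb.le_of_prefix h1 hx
    have h4 := hb.le_of_prefix h2 hy
    have hnot : ∀ d, ¬ b (p ++ [d]) ≤ b (p ++ [!d]) := fun d h =>
      absurd (hb.meet' hp d le_rfl h) (not_le_of_gt (hb.lt p hp d))
    have hinc : ∀ v, b (p ++ [c]) ≤ v → b (p ++ [!c]) ≤ v → False := fun v h h' => by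
      rcases hV.le_or_le h h' with h5 | h5
      · exact hnot c h5
      · exact hnot (!c) (by simpa using h5)
    rcases hV.le_or_le hzx h3 with h5 | h5
    · rcases hV.le_or_le hzy h4 with h6 | h6
      · exact hb.meet' hp c h5 h6
      · exact absurd (h6.trans h5) (by simpa using hnot (!c))
    · exact (hinc (b y) (h5.trans hzy) h4).elim

lemma prefix_of_le (hb : IsBranching r b) (hV : IsRootedForest V) {x y : List Bool}
    (hx : x.length ≤ r) (hy : y.length ≤ r) (h : b x ≤ b y) : x <+: y := by
  obtain ⟨p, h1, h2, h3⟩ := hb.exists_prefix hV hx hy le_rfl h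
  by_cases hpx : p = x
  · exact hpx ▸ h2
  · exact absurd h3 (not_le_of_gt (hb.lt_of_prefix h1 hpx hx))

/-- A branching gives a subdivision of the full binary tree in the covering graph. -/
theorem containsSubdivision [Finite V] (hb : IsBranching r b) (hV : IsRootedForest V)
    (hac : (hasse V).IsAcyclic) {n : ℕ} (hn : n ≤ r + 1) :
    (hasse V).ContainsSubdivision (fullBinaryTree n) := by
  let W := {l : List Bool // l.length < n}
  have hlen : ∀ x : W, x.1.length ≤ r := fun x => by have := x.2; omega
  have hadj : ∀ {x y : W}, (fullBinaryTree n).Adj x y →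
      (∃ c, y.1 = x.1 ++ [c]) ∨ ∃ c, x.1 = y.1 ++ [c] := fun h => h.2
  have hpath : ∀ {x y : W}, (fullBinaryTree n).Adj x y → ∃ p : (hasse V).Walk (b x.1) (b y.1),
      p.IsPath ∧ ∀ z ∈ p.support, (b x.1 ≤ z ∧ z ≤ b y.1) ∨ (b y.1 ≤ z ∧ z ≤ b x.1) := by
    intro x y h
    rcases hadj h with ⟨c, hc⟩ | ⟨c, hc⟩
    · obtain ⟨p, hp, hps, -⟩ := hV.exists_isPath
        (hb.le_of_prefix (hc ▸ List.prefix_append x.1 [c]) (hlen y))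
      exact ⟨p, hp, fun z hz => Or.inl (hps z hz)⟩
    · obtain ⟨p, hp, hps, -⟩ := hV.exists_isPath
        (hb.le_of_prefix (hc ▸ List.prefix_append y.1 [c]) (hlen x))
      exact ⟨p.reverse, hp.reverse, fun z hz => Or.inr (hps z (by simpa using hz))⟩
  have hedge : ∀ {x y : W}, (fullBinaryTree n).Adj x y → ∀ z,
      ((b x.1 ≤ z ∧ z ≤ b y.1) ∨ (b y.1 ≤ z ∧ z ≤ b x.1)) → ∃ (x' y' : W) (c : Bool),
        s(x, y) = s(x', y') ∧ y'.1 = x'.1 ++ [c] ∧ b x'.1 ≤ z ∧ z ≤ b y'.1 := by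
    intro x y h z hz
    rcases hadj h with ⟨c, hc⟩ | ⟨c, hc⟩
    · have h1 := hb.le_of_prefix (hc ▸ List.prefix_append x.1 [c]) (hlen y)
      refine ⟨x, y, c, rfl, hc, ?_⟩
      rcases hz with hz | hz
      · exact hz
      · exact ⟨h1.trans hz.1, hz.2.trans h1⟩
    · have h1 := hb.le_of_prefix (hc ▸ List.prefix_append y.1 [c]) (hlen x)
      refine ⟨y, x, c, Sym2.eq_swap, hc, ?_⟩
      rcases hz with hz | hz
      · exact ⟨h1.trans hz.1, hz.2.trans h1⟩
      · exact hz
  refine ⟨{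
    branch := fun x => b x.1
    branch_injective := fun x y h => Subtype.ext
      ((hb.prefix_of_le hV (hlen x) (hlen y) h.le).eq_of_length_le
        (hb.prefix_of_le hV (hlen y) (hlen x) h.ge).length_le)
    path := fun h => (hpath h).choose
    path_isPath := fun h => (hpath h).choose_spec.1
    -- The paths chosen for the two orientations agree because paths in a forest are unique.
    path_symm := fun h => congrArg Subtype.val ((hac.subsingleton_path _ _).elim
      ⟨_, (hpath h.symm).choose_spec.1⟩ ⟨_, (hpath h).choose_spec.1.reverse⟩)
    eq_end_of_branch_mem := ?_
    disjoint := ?_ }⟩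
  · intro x y h w hw
    obtain ⟨x', y', c, he, hc, h1, h2⟩ := hedge h _ ((hpath h).choose_spec.2 _ hw)
    have h3 := hb.prefix_of_le hV (hlen x') (hlen w) h1
    have h4 := hb.prefix_of_le hV (hlen w) (hlen y') h2
    have h5 : w = x' ∨ w = y' := by
      rw [hc] at h4
      rcases List.prefix_concat_iff.1 h4 with h6 | h6
      · exact Or.inr (Subtype.ext (h6.trans hc.symm))
      · exact Or.inl (Subtype.ext (h6.eq_of_length_le h3.length_le))
    rcases Sym2.eq_iff.1 he with ⟨rfl, rfl⟩ | ⟨rfl, rfl⟩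
    · exact h5
    · exact h5.symm
  · intro x y x' y' h h' hne z hz hz'
    obtain ⟨u, v, c, he, hc, h1, h2⟩ := hedge h _ ((hpath h).choose_spec.2 _ hz)
    obtain ⟨u', v', c', he', hc', h1', h2'⟩ := hedge h' _ ((hpath h').choose_spec.2 _ hz')
    have hl := hlen v
    have hl' := hlen v'
    have hvn := v.2
    have hvn' := v'.2
    rw [hc] at h2 hl hvn
    rw [hc'] at h2' hl' hvn'
    rw [List.length_append, List.length_singleton] at hl hl' hvn hvn'
    have hvv : u.1 ++ [c] ≠ u'.1 ++ [c'] := by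
      intro e
      have hu : u = u' := Subtype.ext (List.append_inj_left' e rfl)
      have hv : v = v' := Subtype.ext (by rw [hc, hc', e])
      exact hne (by rw [he, he', hu, hv])
    -- The lower ends differ, so their common prefix `p` is a prefix of one of the upper ends; then
    -- `b p ≤ z ≤ b p`, and `z` is a branch vertex.
    obtain ⟨p, hpx, hpy, hz⟩ := hb.exists_prefix hV (by simpa using hl) (by simpa using hl') h2 h2'
    by_cases hp : p = u.1 ++ [c]
    · have hp' : p <+: u'.1 := (List.prefix_concat_iff.1 hpy).resolve_left (hp ▸ hvv)
      exact ⟨⟨p, by have := hp'.length_le; omega⟩,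
        ((hb.le_of_prefix hp' (by omega)).trans h1').antisymm hz⟩
    · have hp' : p <+: u.1 := (List.prefix_concat_iff.1 hpx).resolve_left hp
      exact ⟨⟨p, by have := hp'.length_le; omega⟩,
        ((hb.le_of_prefix hp' (by omega)).trans h1).antisymm hz⟩

end IsBranching

end BinaryTree

/-- Two odd multiples of `2 ^ e` have an even multiple between them. This is the ranking of a path
by the ruler sequence. -/
lemma exists_between_padicValNat_lt {a b : ℕ} (ha : 0 < a) (hab : a < b)
    (h : padicValNat 2 a = padicValNat 2 b) :
    ∃ c, a < c ∧ c < b ∧ padicValNat 2 a < padicValNat 2 c := by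
  have key : ∀ n, 0 < n → ∃ m, n = 2 ^ padicValNat 2 n * (2 * m + 1) := by
    intro n hn
    obtain ⟨m, hm⟩ := pow_padicValNat_dvd (p := 2) (n := n)
    have hodd : ¬ 2 ∣ m := by
      rintro ⟨l, rfl⟩
      exact pow_succ_padicValNat_not_dvd (p := 2) hn.ne' ⟨l, by rw [pow_succ, mul_assoc]; exact hm⟩
    obtain ⟨l, rfl⟩ : ∃ l, m = 2 * l + 1 := ⟨m / 2, by omega⟩
    exact ⟨l, hm⟩
  obtain ⟨i, hi⟩ := key a ha
  obtain ⟨j, hj⟩ := key b (ha.trans hab)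
  rw [← h] at hj
  have hpos : 0 < 2 ^ padicValNat 2 a := by positivity
  generalize he : padicValNat 2 a = e at *
  have hij : 2 * i + 1 < 2 * j + 1 := by
    rw [hi, hj] at hab
    exact lt_of_mul_lt_mul_left hab hpos.le
  refine ⟨2 ^ e * (2 * i + 2), ?_, ?_, ?_⟩
  · rw [hi]
    exact Nat.mul_lt_mul_of_pos_left (by omega) hpos
  · rw [hj]
    exact Nat.mul_lt_mul_of_pos_left (by omega) hpos
  · refine (padicValNat_dvd_iff_le (by positivity)).1 ?_
    exact ⟨i + 1, by rw [Nat.succ_eq_add_one, pow_succ]; ring⟩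

/-! ### Strahler numbers and a ranking of forests. -/

section Strahler

variable {V : Type*} [PartialOrder V]

open Classical in
/-- The number of levels, up to `h`, of a largest subdivided binary tree below `v`. -/
noncomputable def strahler (h : ℕ) (v : V) : ℕ :=
  Nat.findGreatest (fun r => ∃ u, v ≤ u ∧ IsBinaryRoot r u) h

lemma exists_isBinaryRoot_strahler (h : ℕ) (v : V) :
    ∃ u, v ≤ u ∧ IsBinaryRoot (strahler h v) u := by
  classical
  exact Nat.findGreatest_spec (P := fun r => ∃ u, v ≤ u ∧ IsBinaryRoot r u) (Nat.zero_le h)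
    ⟨v, le_rfl, trivial⟩

lemma strahler_lt {h : ℕ} (hh : ∀ v : V, ¬ IsBinaryRoot h v) (v : V) : strahler h v < h := by
  classical
  refine lt_of_le_of_ne (Nat.findGreatest_le h) fun e => ?_
  obtain ⟨u, -, hu⟩ := exists_isBinaryRoot_strahler h v
  rw [e] at hu
  exact hh u hu

lemma le_strahler {h r : ℕ} {u v : V} (hr : r ≤ h) (huv : v ≤ u) (hu : IsBinaryRoot r u) :
    r ≤ strahler h v := by
  classical
  exact Nat.le_findGreatest hr ⟨u, huv, hu⟩

lemma strahler_anti {h : ℕ} (hh : ∀ v : V, ¬ IsBinaryRoot h v) {u v : V} (huv : u ≤ v) :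
    strahler h v ≤ strahler h u := by
  obtain ⟨w, hw, hr⟩ := exists_isBinaryRoot_strahler h v
  exact le_strahler (strahler_lt hh v).le (huv.trans hw) hr

/-- Binary trees of equal order below `u` and `v` combine into one of the next order rooted at `m`;
`hh` ensures that the cap `h` does not interfere. -/
lemma IsRootedForest.strahler_lt_meet (hV : IsRootedForest V) {h : ℕ}
    (hh : ∀ v : V, ¬ IsBinaryRoot h v) {u v m : V} (huv : ¬ u ≤ v) (hvu : ¬ v ≤ u)
    (heq : strahler h u = strahler h v) (hmu : m ≤ u) (hmv : m ≤ v)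
    (hm : ∀ z, z ≤ u → z ≤ v → z ≤ m) : strahler h u < strahler h m := by
  obtain ⟨a, hua, ha⟩ := exists_isBinaryRoot_strahler h u
  obtain ⟨b, hvb, hb⟩ := exists_isBinaryRoot_strahler h v
  refine le_strahler (strahler_lt hh u) (le_refl m) ⟨a, b, ?_, ?_, ha, heq ▸ hb, fun z hza hzb => ?_⟩
  · exact (lt_of_le_of_ne hmu fun e => huv (e ▸ hmv)).trans_le hua
  · exact (lt_of_le_of_ne hmv fun e => hvu (e ▸ hmu)).trans_le hvb
  · have h1 : ¬ u ≤ z := fun h => (hV.le_or_le (h.trans hzb) hvb).elim huv hvu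
    have h2 : ¬ v ≤ z := fun h => (hV.le_or_le hua (h.trans hza)).elim huv hvu
    exact hm z ((hV.le_or_le hza hua).resolve_right h1) ((hV.le_or_le hzb hvb).resolve_right h2)

/-- A forest without long paths and large subdivided binary trees has a vertex ranking with few
values. -/
theorem IsRootedForest.exists_isRankingOn [Finite V] (hV : IsRootedForest V) {h : ℕ}
    (hh : ∀ v : V, ¬ IsBinaryRoot h v) (hd : ∀ v : V, forestDepth v ≤ 2 ^ h) :
    ∃ ρ : V → ℕ, (∀ v, ρ v < h * (h + 1)) ∧ IsRankingOn (hasse V) Set.univ ρ := by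
  have hval : ∀ v : V, padicValNat 2 (forestDepth v) ≤ h := fun v =>
    (Nat.pow_le_pow_iff_right (by norm_num : 1 < 2)).1
      ((Nat.le_of_dvd (forestDepth_pos v) pow_padicValNat_dvd).trans (hd v))
  have hlex : ∀ u v : V, strahler h u < strahler h v →
      strahler h u * (h + 1) + padicValNat 2 (forestDepth u) <
        strahler h v * (h + 1) + padicValNat 2 (forestDepth v) := by
    intro u v huv
    have h1 := Nat.mul_le_mul_right (h + 1) huv
    rw [Nat.succ_mul] at h1
    have := hval u
    omega
  -- There are `h` possible Strahler numbers and, since depths are at most `2 ^ h`, `h + 1` possible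
  -- valuations.
  refine ⟨fun v => strahler h v * (h + 1) + padicValNat 2 (forestDepth v), fun v => ?_, ?_⟩
  · have h1 := Nat.mul_le_mul_right (h + 1) (strahler_lt hh v)
    rw [Nat.succ_mul] at h1
    have := hval v
    dsimp only
    omega
  · intro S _ hS u hu v hv hne heq
    dsimp only at heq ⊢
    have hs : strahler h u = strahler h v := by
      rcases lt_trichotomy (strahler h u) (strahler h v) with h1 | h1 | h1
      · exact absurd heq (hlex _ _ h1).ne
      · exact h1
      · exact absurd heq (hlex _ _ h1).ne'
    have hp : padicValNat 2 (forestDepth u) = padicValNat 2 (forestDepth v) := by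
      rw [hs] at heq
      omega
    -- For comparable vertices, the Strahler number is constant between them, and the ruler sequence
    -- supplies a vertex in between, in `S` by convexity.
    have key : ∀ u ∈ S, ∀ v ∈ S, u < v → strahler h u = strahler h v →
        padicValNat 2 (forestDepth u) = padicValNat 2 (forestDepth v) →
        ∃ w ∈ S, strahler h w = strahler h u ∧
          padicValNat 2 (forestDepth u) < padicValNat 2 (forestDepth w) := by
      intro u hu v hv huv hs hp
      obtain ⟨n, h1, h2, h3⟩ :=
        exists_between_padicValNat_lt (forestDepth_pos u) (forestDepth_lt huv) hp
      obtain ⟨w, hwv, rfl⟩ := hV.exists_le_forestDepth_eq (by omega) v h2.le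
      have huw : u ≤ w := by
        rcases hV.le_or_le huv.le hwv with h4 | h4
        · exact h4
        · exact absurd (forestDepth_mono h4) (by omega)
      exact ⟨w, hV.mem_of_le_of_le hS hu hv huw hwv,
        (strahler_anti hh huw).antisymm (hs ▸ strahler_anti hh hwv), h3⟩
    by_cases huv : u ≤ v
    · obtain ⟨w, hw, h1, h2⟩ := key u hu v hv (lt_of_le_of_ne huv hne) hs hp
      exact ⟨w, hw, by rw [h1]; omega⟩
    by_cases hvu : v ≤ u
    · obtain ⟨w, hw, h1, h2⟩ := key v hv u hu (lt_of_le_of_ne hvu hne.symm) hs.symm hp.symm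
      exact ⟨w, hw, by rw [h1, hs]; omega⟩
    obtain ⟨m, hmS, hmu, hmv, hm⟩ := hV.exists_meet hS hu hv
    exact ⟨m, hmS, hlex _ _ (hV.strahler_lt_meet hh huv hvu hs hmu hmv hm)⟩

end Strahler

/-! ### Assembling the bounds. -/

section Main

variable {V : Type*} {G H : SimpleGraph V}

lemma HasPathOfLength.mono (hGH : G ≤ H) {n : ℕ} : G.HasPathOfLength n → H.HasPathOfLength n :=
  fun ⟨u, v, p, hp, hl⟩ => ⟨u, v, p.mapLe hGH, (Walk.isPath_mapLe hGH).2 hp, by simpa using hl⟩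

lemma ContainsSubdivision.mono {W : Type*} {K : SimpleGraph W} (hGH : G ≤ H) :
    G.ContainsSubdivision K → H.ContainsSubdivision K := fun ⟨s⟩ => ⟨{
  branch := s.branch
  branch_injective := s.branch_injective
  path := fun h => (s.path h).mapLe hGH
  path_isPath := fun h => (Walk.isPath_mapLe hGH).2 (s.path_isPath h)
  path_symm := fun h => by rw [s.path_symm, Walk.reverse_mapLe]
  eq_end_of_branch_mem := fun h w hw => s.eq_end_of_branch_mem h w (by simpa using hw)
  disjoint := fun h h' hne x hx hx' =>
    s.disjoint h h' hne x (by simpa using hx) (by simpa using hx') }⟩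

theorem Splits.hasPathOfLength_or_containsSubdivision [Finite V] {h : ℕ} {S : Set V}
    (hS : Splits G (h * (h + 1)) S) :
    G.HasPathOfLength (2 ^ h) ∨ G.ContainsSubdivision (fullBinaryTree h) := by
  obtain ⟨F, hFG, hac, -, hF⟩ := hS.exists_isAcyclic
  obtain ⟨P, hV, rfl⟩ := hac.exists_partialOrder
  by_cases hd : ∀ v : V, forestDepth v ≤ 2 ^ h
  · right
    by_cases hh : ∀ v : V, ¬ IsBinaryRoot h v
    · obtain ⟨ρ, hρ, hr⟩ := hV.exists_isRankingOn hh hd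
      obtain ⟨v, -, hv⟩ := hF.exists_le_rank hr (Set.subset_univ _)
      exact absurd (hρ v) (not_lt_of_ge hv)
    · push Not at hh
      obtain ⟨v, hv⟩ := hh
      obtain ⟨b, -, hb⟩ := hv.exists_branch
      have hb' : IsBranching h b := ⟨fun x hx => (hb x hx).1, fun x hx => (hb x hx).2⟩
      -- `IsBinaryRoot h` yields `h + 1` levels, one more than required.
      exact (hb'.containsSubdivision hV hac (Nat.le_succ h)).mono hFG
  · left
    push Not at hd
    obtain ⟨v, hv⟩ := hd
    exact (hV.hasPathOfLength hv).mono hFG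

lemma exists_isTreeDecomposition_treewidth [Finite V] (G : SimpleGraph V) :
    ∃ (N : Type) (_ : Finite N) (T : SimpleGraph N) (β : N → Finset V),
      G.IsTreeDecomposition T β ∧ ∀ t : N, (β t).card ≤ G.treewidth + 1 := by
  have := Fintype.ofFinite V
  refine Nat.sInf_mem (s := {w : ℕ | ∃ (N : Type) (_ : Finite N) (T : SimpleGraph N)
    (β : N → Finset V), G.IsTreeDecomposition T β ∧ ∀ t : N, (β t).card ≤ w + 1})
    -- The decomposition with a single bag shows that the infimum is attained.
    ⟨Fintype.card V, Unit, inferInstance, ⊥, fun _ => Finset.univ, ⟨.of_subsingleton, ?_, ?_⟩, ?_⟩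
  · intro v
    have : Nonempty {t : Unit | v ∈ (Finset.univ : Finset V)} := ⟨⟨(), by simp⟩⟩
    exact (IsTree.of_subsingleton (V := {t : Unit | v ∈ (Finset.univ : Finset V)})).connected
  · exact fun u v _ => ⟨(), by simp, by simp⟩
  · exact fun _ => Nat.le_succ _

theorem hasPathOfLength_or_containsSubdivision_of_lt_treedepth [Finite V] {h : ℕ}
    (hG : (G.treewidth + 1) * (h * (h + 1)) < G.treedepth) :
    G.HasPathOfLength (2 ^ h) ∨ G.ContainsSubdivision (fullBinaryTree h) := by
  obtain ⟨N, _, T, β, hT, hβ⟩ := exists_isTreeDecomposition_treewidth G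
  by_cases hS : ∃ S, Splits G (h * (h + 1)) S
  · obtain ⟨S, hS⟩ := hS
    exact hS.hasPathOfLength_or_containsSubdivision
  · push Not at hS
    obtain ⟨ρ, hρ, hr⟩ := hT.exists_isRankingOn hβ (h * (h + 1)) Set.univ fun S _ => hS S
    exact absurd (hr.treedepth_le fun v => hρ v (Set.mem_univ v)) (not_le_of_gt hG)

lemma containsSubdivision_fullBinaryTree_zero (G : SimpleGraph V) :
    G.ContainsSubdivision (fullBinaryTree 0) := by
  have : IsEmpty {l : List Bool // l.length < 0} := ⟨fun l => Nat.not_lt_zero _ l.2⟩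
  exact ⟨{
    branch := isEmptyElim
    branch_injective := fun x => isEmptyElim x
    path := fun {a} => isEmptyElim a
    path_isPath := fun {a} => isEmptyElim a
    path_symm := fun {a} => isEmptyElim a
    eq_end_of_branch_mem := fun {a} => isEmptyElim a
    disjoint := fun {a} => isEmptyElim a }⟩

lemma containsSubdivision_fullBinaryTree_one [Nonempty V] (G : SimpleGraph V) :
    G.ContainsSubdivision (fullBinaryTree 1) := by
  have : Subsingleton {l : List Bool // l.length < 1} := ⟨fun x y => Subtype.ext (by
    rw [List.length_eq_zero_iff.1 (Nat.lt_one_iff.1 x.2),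
      List.length_eq_zero_iff.1 (Nat.lt_one_iff.1 y.2)])⟩
  have hno : ∀ {a b}, ¬ (fullBinaryTree 1).Adj a b := fun h => h.ne (Subsingleton.elim _ _)
  exact ⟨{
    branch := fun _ => Classical.arbitrary V
    branch_injective := fun x y _ => Subsingleton.elim x y
    path := fun h => (hno h).elim
    path_isPath := fun h => (hno h).elim
    path_symm := fun h => (hno h).elim
    eq_end_of_branch_mem := fun h => (hno h).elim
    disjoint := fun h => (hno h).elim }⟩

lemma treedepth_eq_zero [IsEmpty V] (G : SimpleGraph V) : G.treedepth = 0 :=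
  Nat.le_zero.1 ((show IsRankingOn G Set.univ (fun _ => 0) from
    fun _ _ _ u => isEmptyElim u).treedepth_le fun v => isEmptyElim v)

theorem exists_hasPathOfLength_or_containsSubdivision [Finite V] (G : SimpleGraph V) :
    ∃ h : ℕ, (1 / 4 : ℝ) * Real.sqrt ((G.treedepth : ℝ) / ((G.treewidth : ℝ) + 1)) ≤ (h : ℝ) ∧
      (G.HasPathOfLength (2 ^ h) ∨ G.ContainsSubdivision (fullBinaryTree h)) := by
  rcases isEmpty_or_nonempty V with hV | hV
  -- Without vertices only `h = 0` is available, which suffices because the treedepth is `0`.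
  · exact ⟨0, by simp [treedepth_eq_zero], Or.inr (containsSubdivision_fullBinaryTree_zero G)⟩
  set q : ℝ := (G.treedepth : ℝ) / ((G.treewidth : ℝ) + 1) with hq
  have hk : (0 : ℝ) < (G.treewidth : ℝ) + 1 := by positivity
  have hq0 : 0 ≤ q := by positivity
  have hs0 := Real.sqrt_nonneg q
  by_cases h2 : Real.sqrt q < 2
  · exact ⟨1, by push_cast; linarith, Or.inr (containsSubdivision_fullBinaryTree_one G)⟩
  push Not at h2
  -- As `h ≥ 1`, one gets `h * (h + 1) ≤ 2 * h ^ 2 ≤ q / 2 < q`, while `2 * h ≥ h + 1 > √q / 2`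
  -- yields the constant `1 / 4`.
  set h := ⌊Real.sqrt q / 2⌋₊ with hh
  have h3 : (h : ℝ) ≤ Real.sqrt q / 2 := Nat.floor_le (by positivity)
  have h4 : Real.sqrt q / 2 < h + 1 := Nat.lt_floor_add_one _
  have h5 : (1 : ℝ) ≤ h := by
    exact_mod_cast Nat.le_floor (α := ℝ) (n := 1) (a := Real.sqrt q / 2) (by push_cast; linarith)
  refine ⟨h, by linarith, hasPathOfLength_or_containsSubdivision_of_lt_treedepth ?_⟩
  have h6 : (h : ℝ) * (h + 1) < q := by
    have h7 : Real.sqrt q * Real.sqrt q = q := Real.mul_self_sqrt hq0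
    nlinarith
  rw [hq, lt_div_iff₀ hk] at h6
  have h8 : ((G.treewidth : ℝ) + 1) * (h * (h + 1)) < G.treedepth := by linarith
  exact_mod_cast h8

theorem le_treewidth_or_containsSubdivision_or_hasPathOfLength [Finite V] (G : SimpleGraph V)
    {k : ℕ} (hk : 1 ≤ k) (hG : 4 * (k : ℝ) ^ 3 ≤ (G.treedepth : ℝ)) :
    k ≤ G.treewidth ∨ G.ContainsSubdivision (fullBinaryTree k) ∨ G.HasPathOfLength (2 ^ k) := by
  by_cases h : k ≤ G.treewidth
  · exact Or.inl h
  refine Or.inr (hasPathOfLength_or_containsSubdivision_of_lt_treedepth ?_).symm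
  have hG' : 4 * k ^ 3 ≤ G.treedepth := by exact_mod_cast hG
  -- Here `tw + 1 ≤ k` and `k + 1 ≤ 2 * k`, so treedepth above `2 * k ^ 3` is enough; the factor `4`
  -- makes the inequality strict.
  calc (G.treewidth + 1) * (k * (k + 1)) ≤ k * (k * (k + k)) := by gcongr; omega
    _ < 4 * k ^ 3 := by
      have : 0 < k ^ 3 := by positivity
      nlinarith
    _ ≤ G.treedepth := hG'

end Main

end SimpleGraph

theorem corollary2 :
    (∃ c : ℝ, 0 < c ∧ ∀ (V : Type*) [Finite V] (G : SimpleGraph V),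
      ∃ h : ℕ, c * Real.sqrt ((G.treedepth : ℝ) / ((G.treewidth : ℝ) + 1)) ≤ (h : ℝ) ∧
        (G.HasPathOfLength (2 ^ h) ∨ G.ContainsSubdivision (SimpleGraph.fullBinaryTree h))) ∧
    (∃ C : ℝ, 0 < C ∧ ∀ k : ℕ, 1 ≤ k → ∀ (V : Type*) [Finite V] (G : SimpleGraph V),
      C * (k : ℝ) ^ 3 ≤ (G.treedepth : ℝ) →
        k ≤ G.treewidth ∨ G.ContainsSubdivision (SimpleGraph.fullBinaryTree k) ∨
          G.HasPathOfLength (2 ^ k)) :=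
  ⟨⟨1 / 4, by norm_num, fun _ _ G => G.exists_hasPathOfLength_or_containsSubdivision⟩,
    4, by norm_num, fun _ hk _ _ G hG =>
      G.le_treewidth_or_containsSubdivision_or_hasPathOfLength hk hG⟩
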